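/- Fix the scalar field $\mathbb{R}$ or $\mathbb{C}$. A Banach space $X$ is finitely representable in $Y$ if for every $\varepsilon>0$ and every finite-dimensional subspace $A\subseteq X$ there are a subspace $B\subseteq Y$ and an isomorphism $u:A\to B$ with $\|u\|\,\|u^{-1}\|\le 1+\varepsilon$. The class $X^{f}$ consists of all Banach spaces $Y$ such that $X$ and $Y$ are finitely representable in each other. Let $\mathfrak{M}$ (the Minkowski space) be the set of all finite-dimensional Banach spaces, isometric spaces being identified, with the topology of the metric $\log d$, where $d(A,B)=\inf\{\|u\|\,\|u^{-1}\| : u:A\to B \text{ an isomorphism}\}$ is the Banach--Mazur distance (spaces of different dimensions are at distance $\infty$; the distance of a zero-dimensional space from itself is $0$). For a Banach space $X$ let $H(X)\subseteq\mathfrak{M}$ be the set of (isometry classes of) its finite-dimensional subspaces. The Minkowski base $\mathfrak{M}(X^{f})$ is the closure $\overline{H(Y)}$ in $\mathfrak{M}$, which is the same set for all $Y\in X^{f}$. **Theorem.** Let $\mathfrak{N}\subseteq\mathfrak{M}$ be a nonempty set of finite-dimensional Banach spaces such that (C) $\mathfrak{N}$ is closed in $\mathfrak{M}$; (H) if $A\in\mathfrak{N}$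 and $B\in H(A)$, then $B\in\mathfrak{N}$; (A$_0$) for any $A,B\in\mathfrak{N}$ there is $C\in\mathfrak{N}$ with $A\in H(C)$ and $B\in H(C)$. Then there exists a Banach space $X$ such that $\mathfrak{N}=\mathfrak{M}(X^{f})$. Moreover, $X$ can be chosen to be an ultraproduct, with respect to some ultrafilter $D$ on the set $\mathfrak{N}$, of the family of all spaces $A\in\mathfrak{N}$, i.e. the quotient of the space of bounded families $(x_A)_{A\in\mathfrak{N}}$, $x_A\in A$, with the supremum norm, by the subspace of families with $\lim_{D}\|x_A\|=0$. -/

import Mathlib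

open scoped ENNReal Topology
open Filter

universe u v w

noncomputable section

/-! ### Finite-dimensional normed spaces up to isometry -/

/-- A norm on `𝕜ⁿ`, for some `n` (the value `n = 0` is allowed). -/
structure FinNorm (𝕜 : Type u) [RCLike 𝕜] where
  /-- the dimension -/
  dim : ℕ
  /-- the norm -/
  toSeminorm : Seminorm 𝕜 (Fin dim → 𝕜)
  eq_zero_of_norm_eq_zero : ∀ x, toSeminorm x = 0 → x = 0

namespace FinNorm

variable {𝕜 : Type u} [RCLike 𝕜]

/-- The vector space `𝕜ⁿ`, to be equipped with the norm `p`. -/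
def Space (p : FinNorm 𝕜) : Type u := Fin p.dim → 𝕜

instance (p : FinNorm 𝕜) : NormedAddCommGroup p.Space :=
  AddGroupNorm.toNormedAddCommGroup (E := Fin p.dim → 𝕜)
    { toFun := fun x => p.toSeminorm x
      map_zero' := map_zero p.toSeminorm
      add_le' := map_add_le_add p.toSeminorm
      neg' := map_neg_eq_map p.toSeminorm
      eq_zero_of_map_eq_zero' := p.eq_zero_of_norm_eq_zero }

instance (p : FinNorm 𝕜) : NormedSpace 𝕜 p.Space where
  toModule := inferInstanceAs (Module 𝕜 (Fin p.dim → 𝕜))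
  norm_smul_le a x := le_of_eq (map_smul_eq_mul p.toSeminorm a x)

instance (p : FinNorm 𝕜) : FiniteDimensional 𝕜 p.Space :=
  inferInstanceAs (FiniteDimensional 𝕜 (Fin p.dim → 𝕜))

instance (p : FinNorm 𝕜) : CompleteSpace p.Space := FiniteDimensional.complete 𝕜 p.Space

/-- Two norms are identified when the spaces that they define are linearly isometric. -/
instance isometrySetoid (𝕜 : Type u) [RCLike 𝕜] : Setoid (FinNorm 𝕜) where
  r p q := Nonempty (p.Space ≃ₗᵢ[𝕜] q.Space)
  iseqv :=
    { refl := fun _ => ⟨LinearIsometryEquiv.refl 𝕜 _⟩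
      symm := fun ⟨e⟩ => ⟨e.symm⟩
      trans := fun ⟨e⟩ ⟨f⟩ => ⟨e.trans f⟩ }

end FinNorm

/-- The Minkowski space: all finite-dimensional Banach spaces over `𝕜`, up to isometry. -/
def Minkowski (𝕜 : Type u) [RCLike 𝕜] : Type u := Quotient (FinNorm.isometrySetoid 𝕜)

namespace Minkowski

variable {𝕜 : Type u} [RCLike 𝕜]

/-- A finite-dimensional Banach space in the isometry class `A`. -/
abbrev Space (A : Minkowski 𝕜) : Type u := (Quotient.out A).Space

end Minkowski

/-! ### Banach–Mazur distance and the topology of the Minkowski space -/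

/-- The Banach–Mazur distance: the infimum of `‖u‖ ‖u⁻¹‖` over all isomorphisms `u`,
equal to `∞` if there are none. -/
def banachMazur (𝕜 : Type u) [RCLike 𝕜] (X : Type v) (Y : Type w)
    [NormedAddCommGroup X] [NormedSpace 𝕜 X] [NormedAddCommGroup Y] [NormedSpace 𝕜 Y] : ℝ≥0∞ :=
  ⨅ u : X ≃L[𝕜] Y, ‖(u : X →L[𝕜] Y)‖ₑ * ‖(u.symm : Y →L[𝕜] X)‖ₑ

section banachMazur

variable (𝕜 : Type u) [RCLike 𝕜]

theorem banachMazur_self_le (X : Type v) [NormedAddCommGroup X] [NormedSpace 𝕜 X] :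
    banachMazur 𝕜 X X ≤ 1 := by
  refine (iInf_le _ (ContinuousLinearEquiv.refl 𝕜 X)).trans ?_
  have h : ‖ContinuousLinearMap.id 𝕜 X‖ₑ ≤ 1 := by
    rw [← ofReal_norm, ← ENNReal.ofReal_one]
    exact ENNReal.ofReal_le_ofReal ContinuousLinearMap.norm_id_le
  calc _ ≤ (1 : ℝ≥0∞) * 1 := mul_le_mul' h h
    _ = 1 := one_mul 1

theorem banachMazur_comm (X : Type v) (Y : Type w)
    [NormedAddCommGroup X] [NormedSpace 𝕜 X] [NormedAddCommGroup Y] [NormedSpace 𝕜 Y] :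
    banachMazur 𝕜 X Y = banachMazur 𝕜 Y X := by
  apply le_antisymm
  · exact le_iInf fun u => (iInf_le _ u.symm).trans (by rw [mul_comm]; simp)
  · exact le_iInf fun u => (iInf_le _ u.symm).trans (by rw [mul_comm]; simp)

/-- The logarithm of the Banach–Mazur distance, with values in `[0, ∞]`; the truncation at `0`
only concerns zero spaces, where `‖u‖ ‖u⁻¹‖ = 0`. -/
def logBanachMazur (X : Type v) (Y : Type w)
    [NormedAddCommGroup X] [NormedSpace 𝕜 X] [NormedAddCommGroup Y] [NormedSpace 𝕜 Y] : ℝ≥0∞ :=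
  (ENNReal.log (banachMazur 𝕜 X Y)).toENNReal

theorem logBanachMazur_triangle (X Y Z : Type v)
    [NormedAddCommGroup X] [NormedSpace 𝕜 X] [NormedAddCommGroup Y] [NormedSpace 𝕜 Y]
    [NormedAddCommGroup Z] [NormedSpace 𝕜 Z] :
    logBanachMazur 𝕜 X Z ≤ logBanachMazur 𝕜 X Y + logBanachMazur 𝕜 Y Z := by
  have h : banachMazur 𝕜 X Z ≤ banachMazur 𝕜 X Y * banachMazur 𝕜 Y Z ∨
      logBanachMazur 𝕜 X Y = ⊤ ∨ logBanachMazur 𝕜 Y Z = ⊤ := by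
    by_cases h1 : IsEmpty (X ≃L[𝕜] Y)
    · right; left; simp [logBanachMazur, banachMazur]
    by_cases h2 : IsEmpty (Y ≃L[𝕜] Z)
    · right; right; simp [logBanachMazur, banachMazur]
    rw [not_isEmpty_iff] at h1 h2
    left
    refine ENNReal.le_iInf_mul_iInf ⟨h1.some, ENNReal.mul_ne_top enorm_ne_top enorm_ne_top⟩
      ⟨h2.some, ENNReal.mul_ne_top enorm_ne_top enorm_ne_top⟩ fun u v => ?_
    refine (iInf_le _ (u.trans v)).trans ?_
    have hu : ‖((u.trans v : X ≃L[𝕜] Z) : X →L[𝕜] Z)‖ₑ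
        ≤ ‖(v : Y →L[𝕜] Z)‖ₑ * ‖(u : X →L[𝕜] Y)‖ₑ :=
      ContinuousLinearMap.opENorm_comp_le (v : Y →L[𝕜] Z) (u : X →L[𝕜] Y)
    have hv : ‖((u.trans v).symm : Z →L[𝕜] X)‖ₑ
        ≤ ‖(u.symm : Y →L[𝕜] X)‖ₑ * ‖(v.symm : Z →L[𝕜] Y)‖ₑ :=
      ContinuousLinearMap.opENorm_comp_le (u.symm : Y →L[𝕜] X) (v.symm : Z →L[𝕜] Y)
    exact (mul_le_mul' hu hv).trans (le_of_eq (by ring))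
  rcases h with h | h | h
  · refine (EReal.toENNReal_le_toENNReal (ENNReal.log_monotone h)).trans ?_
    rw [ENNReal.log_mul_add]
    exact EReal.toENNReal_add_le
  · rw [h, top_add]; exact le_top
  · rw [h, add_top]; exact le_top

end banachMazur

/-- The Minkowski space carries the metric `log d`, with distance `∞` between spaces of different
dimensions: its topology is that of the disjoint union of the Minkowski compacts. (Points at
distance `0` are equal; only the topology is used, so this is not recorded here.) -/
instance (𝕜 : Type u) [RCLike 𝕜] : PseudoEMetricSpace (Minkowski 𝕜) where
  edist A B := logBanachMazur 𝕜 A.Space B.Space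
  edist_self A := by
    rw [logBanachMazur, EReal.toENNReal_of_nonpos]
    rw [← ENNReal.log_one]
    exact ENNReal.log_monotone (banachMazur_self_le 𝕜 _)
  edist_comm A B := by rw [logBanachMazur, logBanachMazur, banachMazur_comm]
  edist_triangle A B C := logBanachMazur_triangle 𝕜 _ _ _

/-! ### Banach spaces, finite representability, the classes `X^f` -/

/-- A Banach space over `𝕜`. -/
structure BanachSpace (𝕜 : Type u) [RCLike 𝕜] : Type (u + 1) where
  /-- the underlying type -/
  carrier : Type u
  [normedAddCommGroup : NormedAddCommGroup carrier]
  [normedSpace : NormedSpace 𝕜 carrier]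
  [completeSpace : CompleteSpace carrier]

attribute [instance] BanachSpace.normedAddCommGroup BanachSpace.normedSpace
  BanachSpace.completeSpace

instance (𝕜 : Type u) [RCLike 𝕜] : CoeSort (BanachSpace 𝕜) (Type u) := ⟨BanachSpace.carrier⟩

/-- `X` is finitely representable in `Y`. -/
def FinRepresentable (𝕜 : Type u) [RCLike 𝕜] (X : Type v) (Y : Type w)
    [NormedAddCommGroup X] [NormedSpace 𝕜 X] [NormedAddCommGroup Y] [NormedSpace 𝕜 Y] : Prop :=
  ∀ ε : ℝ, 0 < ε → ∀ A : Submodule 𝕜 X, FiniteDimensional 𝕜 A →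
    ∃ (B : Submodule 𝕜 Y) (u : A ≃L[𝕜] B),
      ‖(u : A →L[𝕜] B)‖ * ‖(u.symm : B →L[𝕜] A)‖ ≤ 1 + ε

/-- The class `X^f` of all Banach spaces that are finitely equivalent to `X`. -/
def finClass {𝕜 : Type u} [RCLike 𝕜] (X : BanachSpace 𝕜) : Set (BanachSpace 𝕜) :=
  {Y | FinRepresentable 𝕜 X Y ∧ FinRepresentable 𝕜 Y X}

/-- `H(X)`: the isometry classes of the finite-dimensional subspaces of `X`. -/
def finSubspaces (𝕜 : Type u) [RCLike 𝕜] (X : Type v) [NormedAddCommGroup X] [NormedSpace 𝕜 X] :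
    Set (Minkowski 𝕜) :=
  {A | ∃ B : Submodule 𝕜 X, FiniteDimensional 𝕜 B ∧ Nonempty (A.Space ≃ₗᵢ[𝕜] B)}

/-- `S` is the Minkowski base of the (nonempty) class `K` of finite equivalence: it is the
closure of `H(Y)` in the Minkowski space, for each `Y` in `K`. -/
def IsMinkowskiBase {𝕜 : Type u} [RCLike 𝕜] (S : Set (Minkowski 𝕜)) (K : Set (BanachSpace 𝕜)) :
    Prop :=
  K.Nonempty ∧ ∀ Y ∈ K, S = closure (finSubspaces 𝕜 Y)

/-! ### Ultraproducts of Banach spaces -/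

section ultraproduct

variable (𝕜 : Type u) [RCLike 𝕜] {I : Type u} (E : I → Type u)
  [∀ i, NormedAddCommGroup (E i)] [∀ i, NormedSpace 𝕜 (E i)] (D : Ultrafilter I)

/-- The bounded families `x` with `lim_D ‖x i‖ = 0`. -/
def ultraNull : Submodule 𝕜 (lp E ∞) where
  carrier := {x | Tendsto (fun i => ‖x i‖) D (𝓝 0)}
  zero_mem' := by simp
  add_mem' {x y} hx hy := by
    have h := Tendsto.add hx hy
    rw [add_zero] at h
    exact squeeze_zero (fun i => norm_nonneg _) (fun i => norm_add_le (x i) (y i)) h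
  smul_mem' c x hx := by
    have h := Tendsto.const_mul ‖c‖ hx
    rw [mul_zero] at h
    exact h.congr fun i => (norm_smul c (x i)).symm

instance isClosed_ultraNull : IsClosed (ultraNull 𝕜 E D : Set (lp E ∞)) := by
  refine isClosed_of_closure_subset fun x hx => ?_
  refine Metric.tendsto_nhds.2 fun ε hε => ?_
  obtain ⟨y, hy, hxy⟩ := Metric.mem_closure_iff.1 hx (ε / 2) (half_pos hε)
  filter_upwards [Metric.tendsto_nhds.1 hy (ε / 2) (half_pos hε)] with i hi
  have h1 : ‖(x - y) i‖ ≤ ‖x - y‖ := lp.norm_apply_le_norm ENNReal.top_ne_zero (x - y) i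
  have h2 : ‖x i‖ ≤ ‖(x - y) i‖ + ‖y i‖ := by
    simpa using norm_add_le ((x - y) i) (y i)
  rw [dist_eq_norm] at hxy
  simp only [Real.dist_eq, sub_zero, abs_norm] at hi ⊢
  linarith

/-- The ultraproduct `(E i)_D`. -/
def ultraproduct [∀ i, CompleteSpace (E i)] : BanachSpace 𝕜 where
  carrier := lp E ∞ ⧸ ultraNull 𝕜 E D

end ultraproduct

end

/-!
Directedness (A₀) yields an ultrafilter `D` on `𝔑` such that every `A ∈ 𝔑` is a subspace of
`D`-almost every member of `𝔑`; the almost everywhere defined embeddings glue to an isometric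
embedding of `A` into the ultraproduct `X`, so `𝔑 ⊆ H(X)`. Conversely, the norm of `X` is the limit
along `D` of the norms of the components, and by equicontinuity the convergence is uniform on the
unit sphere of a finite-dimensional subspace of `X`. Such a subspace is therefore a limit of
subspaces of the factors, which lie in `𝔑` by (H), so `H(X) ⊆ 𝔑` by (C).
-/

open scoped NNReal

section IsometryClass

variable {𝕜 : Type u} [RCLike 𝕜]

/-- The norm of a finite-dimensional normed space `V`, transported to `𝕜ⁿ` by a basis; this gives
access to the Minkowski space from arbitrary finite-dimensional spaces, in any universe. -/
noncomputable def FinNorm.ofNormedSpace (𝕜 : Type u) [RCLike 𝕜] (V : Type v)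
    [NormedAddCommGroup V] [NormedSpace 𝕜 V] [FiniteDimensional 𝕜 V] : FinNorm 𝕜 where
  dim := Module.finrank 𝕜 V
  toSeminorm := (normSeminorm 𝕜 V).comp (Module.finBasis 𝕜 V).equivFun.symm.toLinearMap
  eq_zero_of_norm_eq_zero x hx :=
    (Module.finBasis 𝕜 V).equivFun.symm.map_eq_zero_iff.1
      (norm_eq_zero.1 (show ‖(Module.finBasis 𝕜 V).equivFun.symm x‖ = 0 from hx))

/-- The basis expansion, as an isometry between the two models of `V`. -/
noncomputable def FinNorm.ofNormedSpaceEquiv (V : Type v) [NormedAddCommGroup V]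
    [NormedSpace 𝕜 V] [FiniteDimensional 𝕜 V] : (FinNorm.ofNormedSpace 𝕜 V).Space ≃ₗᵢ[𝕜] V where
  toLinearEquiv := (Module.finBasis 𝕜 V).equivFun.symm
  norm_map' _ := rfl

/-- The isometry class of a finite-dimensional normed space, as a point of the Minkowski space. -/
noncomputable def Minkowski.mk (𝕜 : Type u) [RCLike 𝕜] (V : Type v) [NormedAddCommGroup V]
    [NormedSpace 𝕜 V] [FiniteDimensional 𝕜 V] : Minkowski 𝕜 :=
  Quotient.mk _ (FinNorm.ofNormedSpace 𝕜 V)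

theorem Minkowski.nonempty_space_mk_linearIsometryEquiv (V : Type v) [NormedAddCommGroup V]
    [NormedSpace 𝕜 V] [FiniteDimensional 𝕜 V] :
    Nonempty ((Minkowski.mk 𝕜 V).Space ≃ₗᵢ[𝕜] V) :=
  (Quotient.mk_out (s := FinNorm.isometrySetoid 𝕜) (FinNorm.ofNormedSpace 𝕜 V)).map
    fun e => e.trans (FinNorm.ofNormedSpaceEquiv V)

end IsometryClass

section FinSubspaces

variable {𝕜 : Type u} [RCLike 𝕜] {X : Type v} [NormedAddCommGroup X] [NormedSpace 𝕜 X]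
  {A : Minkowski 𝕜}

theorem mem_finSubspaces_iff_nonempty_linearIsometry :
    A ∈ finSubspaces 𝕜 X ↔ Nonempty (A.Space →ₗᵢ[𝕜] X) :=
  ⟨fun ⟨V, _, ⟨e⟩⟩ => ⟨V.subtypeₗᵢ.comp e.toLinearIsometry⟩,
    fun ⟨f⟩ => ⟨LinearMap.range f.toLinearMap, inferInstance, ⟨f.equivRange⟩⟩⟩

theorem finSubspaces_subset_of_mem (hA : A ∈ finSubspaces 𝕜 X) :
    finSubspaces 𝕜 A.Space ⊆ finSubspaces 𝕜 X := by
  intro B hB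
  rw [mem_finSubspaces_iff_nonempty_linearIsometry] at hA hB ⊢
  exact hA.map2 LinearIsometry.comp hB

theorem mk_mem_finSubspaces (W : Submodule 𝕜 X) [FiniteDimensional 𝕜 W] :
    Minkowski.mk 𝕜 W ∈ finSubspaces 𝕜 X :=
  ⟨W, inferInstance, Minkowski.nonempty_space_mk_linearIsometryEquiv W⟩

end FinSubspaces

section BanachMazur

variable {𝕜 : Type u} [RCLike 𝕜]

theorem banachMazur_le_ofReal {X : Type v} {Y : Type w} [NormedAddCommGroup X] [NormedSpace 𝕜 X]
    [NormedAddCommGroup Y] [NormedSpace 𝕜 Y] {c : ℝ} (u : X ≃L[𝕜] Y)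
    (hu : ‖(u : X →L[𝕜] Y)‖ * ‖(u.symm : Y →L[𝕜] X)‖ ≤ c) :
    banachMazur 𝕜 X Y ≤ ENNReal.ofReal c := by
  refine (iInf_le _ u).trans ?_
  rw [← ofReal_norm, ← ofReal_norm, ← ENNReal.ofReal_mul (norm_nonneg _)]
  exact ENNReal.ofReal_le_ofReal hu

theorem banachMazur_le_of_linearIsometryEquiv {X X' Y Y' : Type*}
    [NormedAddCommGroup X] [NormedSpace 𝕜 X] [NormedAddCommGroup X'] [NormedSpace 𝕜 X']
    [NormedAddCommGroup Y] [NormedSpace 𝕜 Y] [NormedAddCommGroup Y'] [NormedSpace 𝕜 Y']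
    (e : X ≃ₗᵢ[𝕜] X') (f : Y ≃ₗᵢ[𝕜] Y') :
    banachMazur 𝕜 X Y ≤ banachMazur 𝕜 X' Y' := by
  refine le_iInf fun u => ?_
  let w : X ≃L[𝕜] Y :=
    (e.toContinuousLinearEquiv.trans u).trans f.symm.toContinuousLinearEquiv
  have hw : ‖(w : X →L[𝕜] Y)‖ ≤ ‖(u : X' →L[𝕜] Y')‖ :=
    ContinuousLinearMap.opNorm_le_bound _ (norm_nonneg _) fun x => by
      simpa [w] using (u : X' →L[𝕜] Y').le_opNorm (e x)
  have hw_symm : ‖(w.symm : Y →L[𝕜] X)‖ ≤ ‖(u.symm : Y' →L[𝕜] X')‖ :=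
    ContinuousLinearMap.opNorm_le_bound _ (norm_nonneg _) fun y => by
      simpa [w] using (u.symm : Y' →L[𝕜] X').le_opNorm (f y)
  exact (iInf_le _ w).trans
    (mul_le_mul' (enorm_le_iff_norm_le.2 hw) (enorm_le_iff_norm_le.2 hw_symm))

theorem logBanachMazur_le_ofReal {X : Type v} {Y : Type w}
    [NormedAddCommGroup X] [NormedSpace 𝕜 X] [NormedAddCommGroup Y] [NormedSpace 𝕜 Y] {δ : ℝ}
    (h : banachMazur 𝕜 X Y ≤ ENNReal.ofReal (1 + δ)) :
    logBanachMazur 𝕜 X Y ≤ ENNReal.ofReal δ := by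
  have hlog : ENNReal.log (ENNReal.ofReal (1 + δ)) ≤ (δ : EReal) := by
    rw [ENNReal.log_ofReal]
    split_ifs with hδ
    · exact bot_le
    · exact EReal.coe_le_coe (by linarith [Real.log_le_sub_one_of_pos (not_le.1 hδ)])
  exact EReal.toENNReal_le_toENNReal ((ENNReal.log_monotone h).trans hlog)

theorem Minkowski.mem_closure_of_forall_banachMazur_le {S : Set (Minkowski 𝕜)} {A : Minkowski 𝕜}
    (h : ∀ δ : ℝ, 0 < δ → ∃ B ∈ S, banachMazur 𝕜 A.Space B.Space ≤ ENNReal.ofReal (1 + δ)) :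
    A ∈ closure S := by
  refine EMetric.mem_closure_iff.2 fun ε hε => ?_
  obtain ⟨δ, hδ, hδε⟩ := ENNReal.lt_iff_exists_nnreal_btwn.1 hε
  obtain ⟨B, hB, hAB⟩ := h δ (ENNReal.coe_pos.1 hδ)
  exact ⟨B, hB, ((logBanachMazur_le_ofReal hAB).trans_eq ENNReal.ofReal_coe_nnreal).trans_lt hδε⟩

end BanachMazur

section FinRepresentable

variable {𝕜 : Type u} [RCLike 𝕜]

theorem FinRepresentable.refl (X : Type v) [NormedAddCommGroup X] [NormedSpace 𝕜 X] :
    FinRepresentable 𝕜 X X := fun ε hε A _ => by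
  refine ⟨A, ContinuousLinearEquiv.refl 𝕜 A, ?_⟩
  have h : ‖ContinuousLinearMap.id 𝕜 A‖ ≤ 1 := ContinuousLinearMap.norm_id_le
  exact (mul_le_one₀ h (norm_nonneg _) h).trans (by linarith)

theorem FinRepresentable.finSubspaces_subset_closure {X : Type v} {Y : Type w}
    [NormedAddCommGroup X] [NormedSpace 𝕜 X] [NormedAddCommGroup Y] [NormedSpace 𝕜 Y]
    (h : FinRepresentable 𝕜 X Y) : finSubspaces 𝕜 X ⊆ closure (finSubspaces 𝕜 Y) := by
  rintro A ⟨V, hV, ⟨e⟩⟩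
  refine Minkowski.mem_closure_of_forall_banachMazur_le fun δ hδ => ?_
  obtain ⟨W, u, hu⟩ := h δ hδ V hV
  have : FiniteDimensional 𝕜 W := u.toLinearEquiv.finiteDimensional
  obtain ⟨f⟩ := Minkowski.nonempty_space_mk_linearIsometryEquiv (𝕜 := 𝕜) W
  exact ⟨Minkowski.mk 𝕜 W, mk_mem_finSubspaces W,
    (banachMazur_le_of_linearIsometryEquiv e f).trans (banachMazur_le_ofReal u hu)⟩

theorem isMinkowskiBase_closure_finSubspaces (X : BanachSpace 𝕜) :
    IsMinkowskiBase (closure (finSubspaces 𝕜 X)) (finClass X) :=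
  ⟨⟨X, .refl X, .refl X⟩, fun _ ⟨hXY, hYX⟩ =>
    (closure_minimal hXY.finSubspaces_subset_closure isClosed_closure).antisymm
      (closure_minimal hYX.finSubspaces_subset_closure isClosed_closure)⟩

end FinRepresentable

/-- A linear map that distorts norms by a factor between `1 - ε` and `1 + ε`; it need not be onto,
and for `0 ≤ ε < 1` it makes its domain close to its range in the Banach–Mazur distance. -/
def IsAlmostIsometry {𝕜 : Type u} [RCLike 𝕜] {V : Type v} {E : Type w}
    [NormedAddCommGroup V] [NormedSpace 𝕜 V] [NormedAddCommGroup E] [NormedSpace 𝕜 E]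
    (ε : ℝ) (T : V →ₗ[𝕜] E) : Prop :=
  ∀ v, |‖T v‖ - ‖v‖| ≤ ε * ‖v‖

namespace IsAlmostIsometry

variable {𝕜 : Type u} [RCLike 𝕜] {V : Type v} {E : Type w}
  [NormedAddCommGroup V] [NormedSpace 𝕜 V] [NormedAddCommGroup E] [NormedSpace 𝕜 E]
  {ε : ℝ} {T : V →ₗ[𝕜] E}

theorem of_unit_norm (h : ∀ v, ‖v‖ = 1 → |‖T v‖ - 1| ≤ ε) : IsAlmostIsometry ε T := by
  intro v
  rcases eq_or_ne v 0 with rfl | hv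
  · simp
  have hunit : |‖v‖⁻¹ * ‖T v‖ - 1| ≤ ε := by
    simpa [norm_smul] using h _ (norm_smul_inv_norm (𝕜 := 𝕜) hv)
  calc |‖T v‖ - ‖v‖| = |‖v‖⁻¹ * ‖T v‖ - 1| * |‖v‖| := by
        rw [← abs_mul, sub_mul, one_mul, mul_right_comm, inv_mul_cancel₀ (norm_ne_zero_iff.2 hv),
          one_mul]
    _ ≤ ε * ‖v‖ := by rw [abs_norm]; gcongr

theorem norm_map_le (hT : IsAlmostIsometry ε T) (v : V) : ‖T v‖ ≤ (1 + ε) * ‖v‖ := by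
  linarith [(abs_le.1 (hT v)).2]

theorem le_norm_map (hT : IsAlmostIsometry ε T) (v : V) : (1 - ε) * ‖v‖ ≤ ‖T v‖ := by
  linarith [(abs_le.1 (hT v)).1]

theorem injective (hT : IsAlmostIsometry ε T) (hε : ε < 1) : Function.Injective T := by
  refine (injective_iff_map_eq_zero T).2 fun v hv => norm_le_zero_iff.1 ?_
  have h : (1 - ε) * ‖v‖ ≤ 0 := by simpa [hv] using hT.le_norm_map v
  exact nonpos_of_mul_nonpos_right h (sub_pos.2 hε)

theorem banachMazur_range_le (hT : IsAlmostIsometry ε T) (hε₀ : 0 ≤ ε) (hε₁ : ε < 1) :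
    banachMazur 𝕜 V (LinearMap.range T) ≤ ENNReal.ofReal ((1 + ε) * (1 - ε)⁻¹) := by
  let e : V ≃ₗ[𝕜] LinearMap.range T := LinearEquiv.ofInjective T (hT.injective hε₁)
  have he_symm : ∀ y, ‖e.symm y‖ ≤ (1 - ε)⁻¹ * ‖y‖ := fun y => by
    obtain ⟨v, rfl⟩ := e.surjective y
    rw [e.symm_apply_apply, le_inv_mul_iff₀ (sub_pos.2 hε₁)]
    exact hT.le_norm_map v
  let u : V ≃L[𝕜] LinearMap.range T :=
    e.toContinuousLinearEquivOfBounds (1 + ε) (1 - ε)⁻¹ hT.norm_map_le he_symm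
  refine banachMazur_le_ofReal u (mul_le_mul ?_ ?_ (norm_nonneg _) (by positivity))
  · exact ContinuousLinearMap.opNorm_le_bound _ (by positivity) hT.norm_map_le
  · exact ContinuousLinearMap.opNorm_le_bound _ (inv_nonneg.2 (sub_pos.2 hε₁).le) he_symm

end IsAlmostIsometry

section AlmostIsometry

variable {𝕜 : Type u} [RCLike 𝕜] {ι : Type*} {E : ι → Type*}
  [∀ i, NormedAddCommGroup (E i)] [∀ i, NormedSpace 𝕜 (E i)]

theorem eventually_isAlmostIsometry {V : Type*} [NormedAddCommGroup V] [NormedSpace 𝕜 V]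
    [FiniteDimensional 𝕜 V] {l : Filter ι} {T : ∀ i, V →ₗ[𝕜] E i} {K : ℝ≥0}
    (hK : ∀ i, LipschitzWith K (T i)) (hT : ∀ v, Tendsto (fun i => ‖T i v‖) l (𝓝 ‖v‖))
    {ε : ℝ} (hε : 0 < ε) : ∀ᶠ i in l, IsAlmostIsometry ε (T i) := by
  have : ProperSpace V := FiniteDimensional.proper_rclike 𝕜 V
  have hequi : Equicontinuous fun i (v : Metric.sphere (0 : V) 1) => ‖T i v‖ :=
    (LipschitzWith.uniformEquicontinuous _ (1 * K * 1) fun i =>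
      (lipschitzWith_one_norm.comp (hK i)).comp (LipschitzWith.subtype_val _)).equicontinuous
  have hunif : TendstoUniformly (fun i (v : Metric.sphere (0 : V) 1) => ‖T i v‖)
      (fun v => ‖(v : V)‖) l :=
    UniformFun.tendsto_iff_tendstoUniformly.1 <|
      (hequi.tendsto_uniformFun_iff_pi l _).2 <| tendsto_pi_nhds.2 fun v => hT v
  filter_upwards [Metric.tendstoUniformly_iff.1 hunif ε hε] with i hi
  refine .of_unit_norm fun v hv => ?_
  simpa [Real.dist_eq, hv, abs_sub_comm] using (hi ⟨v, mem_sphere_zero_iff_norm.2 hv⟩).le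

theorem mem_closure_iUnion_finSubspaces {A : Minkowski 𝕜}
    (h : ∀ ε : ℝ, 0 < ε → ∃ i, ∃ T : A.Space →ₗ[𝕜] E i, IsAlmostIsometry ε T) :
    A ∈ closure (⋃ i, finSubspaces 𝕜 (E i)) := by
  refine Minkowski.mem_closure_of_forall_banachMazur_le fun δ hδ => ?_
  obtain ⟨ε, hε₀, hε₁, hεδ⟩ : ∃ ε : ℝ, 0 < ε ∧ ε < 1 ∧ (1 + ε) * (1 - ε)⁻¹ = 1 + δ := by
    have hsub : 1 - δ / (2 + δ) = 2 / (2 + δ) := by field_simp; ring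
    refine ⟨δ / (2 + δ), by positivity, by rw [div_lt_one] <;> linarith, ?_⟩
    rw [hsub]
    field_simp
    ring
  obtain ⟨i, T, hT⟩ := h ε hε₀
  obtain ⟨f⟩ := Minkowski.nonempty_space_mk_linearIsometryEquiv (𝕜 := 𝕜) (LinearMap.range T)
  refine ⟨Minkowski.mk 𝕜 (LinearMap.range T), Set.mem_iUnion.2 ⟨i, mk_mem_finSubspaces _⟩, ?_⟩
  calc banachMazur 𝕜 A.Space (Minkowski.mk 𝕜 (LinearMap.range T)).Space
      ≤ banachMazur 𝕜 A.Space (LinearMap.range T) :=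
        banachMazur_le_of_linearIsometryEquiv (.refl 𝕜 _) f
    _ ≤ ENNReal.ofReal (1 + δ) := hεδ ▸ hT.banachMazur_range_le hε₀.le hε₁

end AlmostIsometry

section Ultraproduct

/-- The linear map into `lp E p` with prescribed components, the analogue of `LinearMap.pi`. -/
def lpPi {𝕜 : Type*} [NormedRing 𝕜] {ι V : Type*} {E : ι → Type*} [AddCommGroup V] [Module 𝕜 V]
    [∀ i, NormedAddCommGroup (E i)] [∀ i, Module 𝕜 (E i)] [∀ i, IsBoundedSMul 𝕜 (E i)] {p : ℝ≥0∞}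
    (T : ∀ i, V →ₗ[𝕜] E i) (hT : ∀ v, Memℓp (fun i => T i v) p) : V →ₗ[𝕜] lp E p where
  toFun v := ⟨fun i => T i v, hT v⟩
  map_add' v w := by ext i; exact map_add (T i) v w
  map_smul' c v := by ext i; exact map_smul (T i) c v

variable {𝕜 : Type u} [RCLike 𝕜] {I : Type u} {E : I → Type u}
  [∀ i, NormedAddCommGroup (E i)] [∀ i, NormedSpace 𝕜 (E i)] {D : Ultrafilter I}

-- Replacing the components of norm greater than `c` by `0` does not change the class of `x`.
theorem norm_mkQ_ultraNull_le {x : lp E ∞} {c : ℝ} (hx : ∀ᶠ i in (D : Filter I), ‖x i‖ ≤ c) :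
    ‖(ultraNull 𝕜 E D).mkQ x‖ ≤ c := by
  classical
  have hc : 0 ≤ c := hx.exists.elim fun i hi => (norm_nonneg _).trans hi
  have hbound : ∀ i, ‖if ‖x i‖ ≤ c then x i else 0‖ ≤ c := fun i => by
    split_ifs with hi
    exacts [hi, norm_zero.trans_le hc]
  let y : lp E ∞ := ⟨fun i => if ‖x i‖ ≤ c then x i else 0,
    memℓp_infty ⟨c, Set.forall_mem_range.2 hbound⟩⟩
  have hxy : (ultraNull 𝕜 E D).mkQ x = (ultraNull 𝕜 E D).mkQ y := by
    refine (Submodule.Quotient.eq _).2 (tendsto_const_nhds.congr' (hx.mono fun i hi => ?_))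
    change 0 = ‖x i - if ‖x i‖ ≤ c then x i else 0‖
    rw [if_pos hi, sub_self, norm_zero]
  calc ‖(ultraNull 𝕜 E D).mkQ x‖ = ‖(ultraNull 𝕜 E D).mkQ y‖ := by rw [hxy]
    _ ≤ ‖y‖ := Submodule.Quotient.norm_mk_le _ y
    _ ≤ c := lp.norm_le_of_forall_le hc hbound

theorem le_norm_mkQ_ultraNull {x : lp E ∞} {c : ℝ} (hx : ∀ᶠ i in (D : Filter I), c ≤ ‖x i‖) :
    c ≤ ‖(ultraNull 𝕜 E D).mkQ x‖ := by
  refine QuotientAddGroup.le_norm_iff.2 fun y hy => ?_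
  have hyx : Tendsto (fun i => ‖(y - x) i‖) D (𝓝 0) :=
    (Submodule.Quotient.eq (ultraNull 𝕜 E D)).1 hy
  refine le_of_tendsto (f := fun i => c - ‖(y - x) i‖) (by simpa using hyx.const_sub c) ?_
  filter_upwards [hx] with i hi
  calc c - ‖(y - x) i‖ ≤ ‖x i‖ - ‖(y - x) i‖ := by gcongr
    _ ≤ ‖y i‖ := by
      rw [sub_le_iff_le_add, lp.coeFn_sub, Pi.sub_apply]
      exact norm_le_norm_add_norm_sub _ _
    _ ≤ ‖y‖ := lp.norm_apply_le_norm ENNReal.top_ne_zero y i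

variable (D) in
theorem tendsto_norm_mkQ_ultraNull (x : lp E ∞) :
    Tendsto (fun i => ‖x i‖) D (𝓝 ‖(ultraNull 𝕜 E D).mkQ x‖) := by
  -- An ultrafilter decides each inequality, so the limit exists without a compactness argument.
  refine tendsto_order.2 ⟨fun a ha => ?_, fun b hb => ?_⟩ <;> by_contra h <;>
    rw [← Ultrafilter.eventually_not] at h
  · exact ha.not_ge (norm_mkQ_ultraNull_le (h.mono fun _ => not_lt.1))
  · exact hb.not_ge (le_norm_mkQ_ultraNull (h.mono fun _ => not_lt.1))

variable [∀ i, CompleteSpace (E i)] {V : Type*} [NormedAddCommGroup V] [NormedSpace 𝕜 V]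

theorem nonempty_linearIsometry_ultraproduct
    (h : ∀ᶠ i in (D : Filter I), Nonempty (V →ₗᵢ[𝕜] E i)) :
    Nonempty (V →ₗᵢ[𝕜] ultraproduct 𝕜 E D) := by
  have hext : ∀ i, ∃ T : V →ₗ[𝕜] E i, (∀ v, ‖T v‖ ≤ ‖v‖) ∧
      (Nonempty (V →ₗᵢ[𝕜] E i) → ∀ v, ‖T v‖ = ‖v‖) := fun i => by
    by_cases hi : Nonempty (V →ₗᵢ[𝕜] E i)
    · obtain ⟨f⟩ := hi
      exact ⟨f.toLinearMap, fun v => (f.norm_map v).le, fun _ => f.norm_map⟩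
    · exact ⟨0, by simp, fun hi' => absurd hi' hi⟩
  choose T hT_le hT_eq using hext
  let S : V →ₗ[𝕜] lp E ∞ :=
    lpPi T fun v => memℓp_infty ⟨‖v‖, Set.forall_mem_range.2 fun i => hT_le i v⟩
  refine ⟨⟨(ultraNull 𝕜 E D).mkQ ∘ₗ S, fun v => ?_⟩⟩
  refine tendsto_nhds_unique (tendsto_norm_mkQ_ultraNull D (S v)) ?_
  exact tendsto_const_nhds.congr' (h.mono fun i hi => (hT_eq i hi v).symm)

theorem eventually_exists_isAlmostIsometry [FiniteDimensional 𝕜 V]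
    (f : V →ₗᵢ[𝕜] ultraproduct 𝕜 E D) {ε : ℝ} (hε : 0 < ε) :
    ∀ᶠ i in (D : Filter I), ∃ T : V →ₗ[𝕜] E i, IsAlmostIsometry ε T := by
  obtain ⟨s, hs⟩ := (ultraNull 𝕜 E D).mkQ.exists_rightInverse_of_surjective
    (Submodule.range_mkQ _)
  let S : V →L[𝕜] lp E ∞ := LinearMap.toContinuousLinearMap (s ∘ₗ f.toLinearMap)
  have hS : ∀ v, ‖(ultraNull 𝕜 E D).mkQ (S v)‖ = ‖v‖ := fun v =>
    (congrArg norm (LinearMap.congr_fun hs (f v))).trans (f.norm_map v)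
  let T : ∀ i, V →ₗ[𝕜] E i := fun i => lp.evalₗ E ∞ i ∘ₗ S.toLinearMap
  have hT_lip : ∀ i, LipschitzWith ‖S‖₊ (T i) := fun i =>
    AddMonoidHomClass.lipschitz_of_bound_nnnorm (T i) ‖S‖₊ fun v =>
      (lp.norm_apply_le_norm ENNReal.top_ne_zero (S v) i).trans (S.le_opNorm v)
  have hT_lim : ∀ v, Tendsto (fun i => ‖T i v‖) D (𝓝 ‖v‖) := fun v =>
    hS v ▸ tendsto_norm_mkQ_ultraNull D (S v)
  exact (eventually_isAlmostIsometry hT_lip hT_lim hε).mono fun i hi => ⟨T i, hi⟩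

theorem finSubspaces_ultraproduct_subset_closure :
    finSubspaces 𝕜 (ultraproduct 𝕜 E D) ⊆ closure (⋃ i, finSubspaces 𝕜 (E i)) := by
  intro A hA
  obtain ⟨f⟩ := mem_finSubspaces_iff_nonempty_linearIsometry.1 hA
  exact mem_closure_iUnion_finSubspaces fun ε hε =>
    (eventually_exists_isAlmostIsometry f hε).exists

end Ultraproduct

theorem exists_ultrafilter_forall_eventually {α : Type*} [Nonempty α] {r : α → α → Prop}
    (htrans : ∀ a b c, r a b → r b c → r a c) (hdir : ∀ a b, ∃ c, r a c ∧ r b c) :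
    ∃ D : Ultrafilter α, ∀ a, ∀ᶠ b in (D : Filter α), r a b := by
  have hdir' : Directed (· ≥ ·) fun a => 𝓟 {b | r a b} := fun a b => by
    obtain ⟨c, hac, hbc⟩ := hdir a b
    exact ⟨c, principal_mono.2 fun d hcd => htrans a c d hac hcd,
      principal_mono.2 fun d hcd => htrans b c d hbc hcd⟩
  have : NeBot (⨅ a, 𝓟 {b | r a b}) := iInf_neBot_of_directed hdir' fun a =>
    principal_neBot_iff.2 ((hdir a a).imp fun _ => And.left)
  exact ⟨.of _, fun a => Ultrafilter.of_le _ (mem_iInf_of_mem a (mem_principal_self _))⟩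

theorem theorem1 {𝕜 : Type u} [RCLike 𝕜] (𝔑 : Set (Minkowski 𝕜)) (hne : 𝔑.Nonempty)
    (hC : IsClosed 𝔑)
    (hH : ∀ A ∈ 𝔑, ∀ B ∈ finSubspaces 𝕜 A.Space, B ∈ 𝔑)
    (hA₀ : ∀ A ∈ 𝔑, ∀ B ∈ 𝔑, ∃ C ∈ 𝔑,
      A ∈ finSubspaces 𝕜 C.Space ∧ B ∈ finSubspaces 𝕜 C.Space) :
    ∃ X : BanachSpace 𝕜, IsMinkowskiBase 𝔑 (finClass X) ∧
      ∃ D : Ultrafilter 𝔑,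
        Nonempty (X ≃ₗᵢ[𝕜] ultraproduct 𝕜 (fun A : 𝔑 => (A : Minkowski 𝕜).Space) D) := by
  have : Nonempty 𝔑 := hne.to_subtype
  obtain ⟨D, hD⟩ : ∃ D : Ultrafilter 𝔑, ∀ A : 𝔑, ∀ᶠ C : 𝔑 in (D : Filter 𝔑),
      (A : Minkowski 𝕜) ∈ finSubspaces 𝕜 (C : Minkowski 𝕜).Space :=
    exists_ultrafilter_forall_eventually (fun _ _ _ hAB hBC => finSubspaces_subset_of_mem hBC hAB)
      fun A B => (hA₀ A A.2 B B.2).elim fun C ⟨hC, hABC⟩ => ⟨⟨C, hC⟩, hABC⟩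
  let X := ultraproduct 𝕜 (fun A : 𝔑 => (A : Minkowski 𝕜).Space) D
  have h_sub : 𝔑 ⊆ finSubspaces 𝕜 X := fun A hA =>
    mem_finSubspaces_iff_nonempty_linearIsometry.2 <| nonempty_linearIsometry_ultraproduct <|
      (hD ⟨A, hA⟩).mono fun _ => mem_finSubspaces_iff_nonempty_linearIsometry.1
  have h_sup : finSubspaces 𝕜 X ⊆ 𝔑 := finSubspaces_ultraproduct_subset_closure.trans <|
    closure_minimal (Set.iUnion_subset fun A => hH A A.2) hC
  have hX : closure (finSubspaces 𝕜 X) = 𝔑 := by rw [h_sup.antisymm h_sub, hC.closure_eq]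
  exact ⟨X, hX ▸ isMinkowskiBase_closure_finSubspaces X, D, ⟨.refl 𝕜 X⟩⟩
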